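/- **Setting.** For $w\ge 1$ even, let $\sigma_2:\mathbb R^w\to\mathbb R^w$ be the GroupSort activation with grouping size $2$, which splits the coordinates into consecutive pairs and sorts each pair in decreasing order. A GroupSort network of depth $l\ge 1$ is a map $N=h_l\circ\dots\circ h_1:\mathbb R^d\to\mathbb R^p$ with $h_1(x)=W_1x+b_1$ and $h_i(x)=W_i\sigma_2(x)+b_i$ for $2\le i\le l$, where the hidden widths $w_1,\dots,w_{l-1}$ (the output dimensions of $h_1,\dots,h_{l-1}$) are positive and even; its size is $s=\sum_{i=1}^{l-1}w_i$. With $\|\cdot\|$ the Euclidean norm, $\|\cdot\|_\infty$ the maximum norm of vectors, $\|W\|_\infty=\sup_{\|x\|_\infty=1}\|Wx\|_\infty$ and $\|W\|_{2,\infty}=\sup_{\|x\|=1}\|Wx\|_\infty$, let $\mathcal N^p_C(l,s)$ be the class of GroupSort networks $\mathbb R^d\to\mathbb R^p$ of depth $l$ and size $s$ that can be written with $\|W_1\|_{2,\infty}\le 1$, $\|W_i\|_\infty\le 1$ for $2\le i\le l$, and $\|b_i\|_\infty\le C$ for $1\le i\le l$. **Theorem.** For every $R$ there is a constant $c>0$,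 depending only on $R$, such that the following holds for all integers $d,p\ge 1$ and every compact set $\Omega\subset\mathbb R^d$ contained in the closed ball of radius $R$ centred at the origin. Let $\mathcal G$ be a class of $1$-Lipschitz maps $\Omega\to\mathbb R^p$ (for the Euclidean norms) with $\sup_{g\in\mathcal G}\sup_{x\in\Omega}\|g(x)\|\le K$ for some $K>0$, let $\varepsilon>0$, and set $$C=K+\sqrt d\Big(\sup_{x\in\Omega}\|x\|+1\Big)+\varepsilon .$$ Then for every $g\in\mathcal G$ there are $l,s$ and a network $N\in\mathcal N^p_C(l,s)$ with $$l\le c\,d^2\max\Big(1,\log_2\frac{2\sqrt d\sqrt p}{\varepsilon}\Big),\qquad s\le c\,p\Big(\frac{2\sqrt d\sqrt p}{\varepsilon}\Big)^{d^2},$$ such that $\sup_{x\in\Omega}\|N(x)-g(x)\|\le\varepsilon$. -/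

import Mathlib

/-- The GroupSort activation with grouping size 2: the coordinates are split into the consecutive
pairs `(0,1), (2,3), …` and each pair is sorted in decreasing order. (A leftover coordinate, which
exists only in odd width, is kept; hidden widths below are always even.) -/
noncomputable def groupSort₂ {w : ℕ} (x : Fin w → ℝ) : Fin w → ℝ := fun i =>
  if i.val % 2 = 0 then
    if h : i.val + 1 < w then max (x i) (x ⟨i.val + 1, h⟩) else x i
  else
    min (x ⟨i.val - 1, lt_of_le_of_lt (Nat.sub_le _ _) i.isLt⟩) (x i)

/-- `‖W‖_∞ = sup_{‖x‖_∞ = 1} ‖W x‖_∞` (the norm of `Fin n → ℝ` is the maximum norm). -/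
noncomputable def matNormInf {m n : ℕ} (W : Matrix (Fin m) (Fin n) ℝ) : ℝ :=
  ⨆ x : Metric.sphere (0 : Fin n → ℝ) 1, ‖W.mulVec (x : Fin n → ℝ)‖

/-- `‖W‖_{2,∞} = sup_{‖x‖_2 = 1} ‖W x‖_∞`. -/
noncomputable def matNormTwoInf {m n : ℕ} (W : Matrix (Fin m) (Fin n) ℝ) : ℝ :=
  ⨆ x : Metric.sphere (0 : EuclideanSpace ℝ (Fin n)) 1,
    ‖W.mulVec (x : EuclideanSpace ℝ (Fin n)).ofLp‖

/-- The layers `h_2, …, h_l` of a GroupSort network with output dimension `p`, applied to the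
output of the preceding layer, of width `w`. A layer that is followed by another one is a hidden
layer, whose width is positive and even. -/
inductive GroupSortLayers (p : ℕ) : ℕ → Type
  | nil : GroupSortLayers p p
  | cons {w w' : ℕ} (hpos : 0 < w) (heven : Even w)
      (W : Matrix (Fin w') (Fin w) ℝ) (b : Fin w' → ℝ)
      (rest : GroupSortLayers p w') : GroupSortLayers p w

namespace GroupSortLayers

/-- The function `h_l ∘ … ∘ h_2`, with `h_i x = W_i σ₂(x) + b_i`. -/
noncomputable def eval {p : ℕ} : {w : ℕ} → GroupSortLayers p w → (Fin w → ℝ) → (Fin p → ℝ)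
  | _, nil, x => x
  | _, cons _ _ W b rest, x => rest.eval (W.mulVec (groupSort₂ x) + b)

/-- The number of layers. -/
def length {p : ℕ} : {w : ℕ} → GroupSortLayers p w → ℕ
  | _, nil => 0
  | _, cons _ _ _ _ rest => rest.length + 1

/-- The sum of the widths of the hidden layers (the inputs of the layers in the list). -/
def size {p : ℕ} : {w : ℕ} → GroupSortLayers p w → ℕ
  | _, nil => 0
  | w, cons _ _ _ _ rest => w + rest.size

/-- `‖W_i‖_∞ ≤ 1` and `‖b_i‖_∞ ≤ C` for all layers in the list. -/
def Bounded {p : ℕ} (C : ℝ) : {w : ℕ} → GroupSortLayers p w → Prop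
  | _, nil => True
  | _, cons _ _ W b rest => matNormInf W ≤ 1 ∧ ‖b‖ ≤ C ∧ rest.Bounded C

end GroupSortLayers

/-- The parameters of a GroupSort feed-forward network (grouping size 2) from `ℝ^d` to `ℝ^p`:
the affine first layer `h_1 x = W_1 x + b_1`, then the layers `h_2, …, h_l`. -/
structure GroupSortNet (d p : ℕ) where
  /-- The width of the first layer (equal to `p` if the depth is one). -/
  w₁ : ℕ
  W₁ : Matrix (Fin w₁) (Fin d) ℝ
  b₁ : Fin w₁ → ℝ
  layers : GroupSortLayers p w₁

namespace GroupSortNet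

/-- The function computed by the network. -/
noncomputable def eval {d p : ℕ} (N : GroupSortNet d p) (x : EuclideanSpace ℝ (Fin d)) :
    EuclideanSpace ℝ (Fin p) :=
  WithLp.toLp 2 (N.layers.eval (N.W₁.mulVec x.ofLp + N.b₁))

/-- The depth `l`: the number of layers `h_1, …, h_l`. -/
def depth {d p : ℕ} (N : GroupSortNet d p) : ℕ := N.layers.length + 1

/-- The size `s = w_1 + … + w_{l-1}`: the sum of the hidden widths. -/
def size {d p : ℕ} (N : GroupSortNet d p) : ℕ := N.layers.size

/-- `‖W_1‖_{2,∞} ≤ 1`, `‖W_i‖_∞ ≤ 1` for `i ≥ 2`, and `‖b_i‖_∞ ≤ C` for all `i`. -/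
def Bounded {d p : ℕ} (C : ℝ) (N : GroupSortNet d p) : Prop :=
  matNormTwoInf N.W₁ ≤ 1 ∧ ‖N.b₁‖ ≤ C ∧ N.layers.Bounded C

end GroupSortNet

/-- The class `𝒩^p_C(l, s)` of functions `ℝ^d → ℝ^p` computed by a GroupSort network of depth `l`
and size `s` whose parameters satisfy the norm constraints with the constant `C`. -/
def groupSortClass (d p : ℕ) (C : ℝ) (l s : ℕ) :
    Set (EuclideanSpace ℝ (Fin d) → EuclideanSpace ℝ (Fin p)) :=
  {F | ∃ N : GroupSortNet d p, N.depth = l ∧ N.size = s ∧ N.Bounded C ∧ N.eval = F}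

open Real Set

/-! Each coordinate of `g` is interpolated on a finite net of points `y j` in `Ω` by a max-min of
affine functions, `max_j min_k (v q j + ⟪w q j k, x - y j⟫)` with slopes of norm at most 1. Every
affine piece of block `j` takes the data value at `y j`, and at any other net point `y i` some piece
of the block lies below the data, so the maximum over `j` interpolates. The max-min is 1-Lipschitz,
as is each coordinate of `g`, so off the net the error per coordinate is at most twice the mesh.
Sorting pairs and keeping one entry of each halves the width, so a binary tournament of min layers
followed by max layers computes such a formula (`exists_interpolating_net`). With mesh `√d / u`, the
net has at most `(5Ru)^d` points. In dimension at least 2 there is one slope per pair of points,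
hence about `(5Ru)^(2d)` pieces per output, which `exists_const_mul_pow_le` absorbs into `c *
u^(d^2)`. In dimension 1 this would be quadratic in `u` where linear is required, but there the two
slopes `±1` suffice. -/

/-! ### Binary tournaments of minima and maxima -/

/-- Combine the entries of a sequence in consecutive pairs by a binary operation. -/
def pairFold (op : ℝ → ℝ → ℝ) (f : ℕ → ℝ) : ℕ → ℝ := fun i => op (f (2 * i)) (f (2 * i + 1))

theorem le_pairFold_min_iterate (b : ℕ) (f : ℕ → ℝ) (i : ℕ) (t : ℝ) :
    t ≤ (pairFold min)^[b] f i ↔ ∀ k < 2 ^ b, t ≤ f (2 ^ b * i + k) := by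
  induction b generalizing f with
  | zero => simp
  | succ b ih =>
    rw [Function.iterate_succ_apply, ih]
    simp only [pairFold, le_min_iff]
    constructor
    · intro h k hk
      have hk' : k / 2 < 2 ^ b := by rw [pow_succ] at hk; omega
      obtain ⟨h0, h1⟩ := h (k / 2) hk'
      rcases Nat.even_or_odd' k with ⟨j, rfl | rfl⟩
      · rw [show 2 * j / 2 = j by omega] at h0
        rwa [show 2 ^ (b + 1) * i + 2 * j = 2 * (2 ^ b * i + j) by ring]
      · rw [show (2 * j + 1) / 2 = j by omega] at h1
        rwa [show 2 ^ (b + 1) * i + (2 * j + 1) = 2 * (2 ^ b * i + j) + 1 by ring]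
    · intro h k hk
      have h0 := h (2 * k) (by rw [pow_succ]; omega)
      have h1 := h (2 * k + 1) (by rw [pow_succ]; omega)
      rw [show 2 ^ (b + 1) * i + 2 * k = 2 * (2 ^ b * i + k) by ring] at h0
      rw [show 2 ^ (b + 1) * i + (2 * k + 1) = 2 * (2 ^ b * i + k) + 1 by ring] at h1
      exact ⟨h0, h1⟩

theorem pairFold_max_iterate_le (b : ℕ) (f : ℕ → ℝ) (i : ℕ) (t : ℝ) :
    (pairFold max)^[b] f i ≤ t ↔ ∀ k < 2 ^ b, f (2 ^ b * i + k) ≤ t := by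
  have key : ∀ (b : ℕ) (f : ℕ → ℝ),
      (pairFold max)^[b] f = fun i => -(pairFold min)^[b] (fun n => -f n) i := by
    intro b
    induction b with
    | zero => intro f; simp
    | succ b ih =>
      intro f
      rw [Function.iterate_succ_apply, ih, Function.iterate_succ_apply]
      have e : (fun n => -pairFold max f n) = pairFold min fun n => -f n := by
        ext n
        simp [pairFold, min_neg_neg]
      rw [e]
  rw [key]
  simp only [neg_le (b := t), le_pairFold_min_iterate, neg_le_neg_iff]

/-- A nonexpansive operation keeps the tournament nonexpansive in the sup norm; this yields the
Lipschitz bound for the network. -/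
theorem abs_pairFold_iterate_sub_le {op : ℝ → ℝ → ℝ}
    (hop : ∀ a b c d : ℝ, |op a b - op c d| ≤ max |a - c| |b - d|) {δ : ℝ} (b : ℕ)
    {f f' : ℕ → ℝ} (h : ∀ n, |f n - f' n| ≤ δ) (i : ℕ) :
    |(pairFold op)^[b] f i - (pairFold op)^[b] f' i| ≤ δ := by
  induction b generalizing f f' with
  | zero => exact h i
  | succ b ih =>
    rw [Function.iterate_succ_apply, Function.iterate_succ_apply]
    exact ih fun n => (hop _ _ _ _).trans (max_le (h _) (h _))

/-! ### Tournaments as GroupSort layers -/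

/-- The matrix of the map `x ↦ x ∘ σ`. -/
def selectMatrix {m n : ℕ} (σ : Fin m → Fin n) : Matrix (Fin m) (Fin n) ℝ :=
  Matrix.of fun i j => if j = σ i then 1 else 0

theorem selectMatrix_mulVec {m n : ℕ} (σ : Fin m → Fin n) (x : Fin n → ℝ) :
    (selectMatrix σ).mulVec x = x ∘ σ := by
  ext i
  simp [selectMatrix, Matrix.mulVec, dotProduct]

theorem matNormInf_selectMatrix_le {m n : ℕ} (σ : Fin m → Fin n) :
    matNormInf (selectMatrix σ) ≤ 1 := by
  refine Real.iSup_le (fun x => ?_) zero_le_one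
  have hx : ‖(x : Fin n → ℝ)‖ = 1 := norm_eq_of_mem_sphere x
  rw [selectMatrix_mulVec]
  exact (pi_norm_le_iff_of_nonneg zero_le_one).2 fun i => (norm_le_pi_norm (x : Fin n → ℝ) (σ i)).trans hx.le

theorem matNormTwoInf_le_one {m n : ℕ} (w : Fin m → EuclideanSpace ℝ (Fin n))
    (hw : ∀ i, ‖w i‖ ≤ 1) : matNormTwoInf (Matrix.of fun i j => w i j) ≤ 1 := by
  refine Real.iSup_le (fun x => ?_) zero_le_one
  have hx : ‖(x : EuclideanSpace ℝ (Fin n))‖ = 1 := norm_eq_of_mem_sphere x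
  refine (pi_norm_le_iff_of_nonneg zero_le_one).2 fun i => ?_
  have : (Matrix.of fun i j => w i j).mulVec (x : EuclideanSpace ℝ (Fin n)).ofLp i
      = inner ℝ (w i) (x : EuclideanSpace ℝ (Fin n)) := by
    simp [Matrix.mulVec, dotProduct, PiLp.inner_apply, mul_comm]
  rw [this]
  calc _ ≤ ‖w i‖ * ‖(x : EuclideanSpace ℝ (Fin n))‖ := norm_inner_le_norm _ _
    _ ≤ 1 := by rw [hx, mul_one]; exact hw i

namespace GroupSortLayers

theorem exists_max {p w : ℕ} {C : ℝ} (hC : 0 ≤ C) (hw : 0 < w) (L : GroupSortLayers p w)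
    (hL : L.Bounded C) {n : ℕ} (hn : n = w * 2) :
    ∃ L' : GroupSortLayers p n, L'.length = L.length + 1 ∧ L'.size = n + L.size ∧
      L'.Bounded C ∧ ∀ f : ℕ → ℝ,
        L'.eval (fun i => f i) = L.eval (fun i => pairFold max f i) := by
  subst hn
  have hpos : 0 < w * 2 := by omega
  have heven : Even (w * 2) := ⟨w, by ring⟩
  -- Decreasing order puts the maximum of each pair in its even slot; the minimum is in the odd one.
  let σ : Fin w → Fin (w * 2) := fun i => ⟨2 * i, by omega⟩
  refine ⟨cons hpos heven (selectMatrix σ) 0 L, rfl, rfl,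
    ⟨matNormInf_selectMatrix_le σ, by simpa using hC, hL⟩, fun f => ?_⟩
  rw [eval, selectMatrix_mulVec]
  congr 1
  ext i
  have : 2 * i.val + 1 < w * 2 := by omega
  simp [σ, groupSort₂, pairFold, this]

theorem exists_min {p w : ℕ} {C : ℝ} (hC : 0 ≤ C) (hw : 0 < w) (L : GroupSortLayers p w)
    (hL : L.Bounded C) {n : ℕ} (hn : n = w * 2) :
    ∃ L' : GroupSortLayers p n, L'.length = L.length + 1 ∧ L'.size = n + L.size ∧
      L'.Bounded C ∧ ∀ f : ℕ → ℝ,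
        L'.eval (fun i => f i) = L.eval (fun i => pairFold min f i) := by
  subst hn
  have hpos : 0 < w * 2 := by omega
  have heven : Even (w * 2) := ⟨w, by ring⟩
  let σ : Fin w → Fin (w * 2) := fun i => ⟨2 * i + 1, by omega⟩
  refine ⟨cons hpos heven (selectMatrix σ) 0 L, rfl, rfl,
    ⟨matNormInf_selectMatrix_le σ, by simpa using hC, hL⟩, fun f => ?_⟩
  rw [eval, selectMatrix_mulVec]
  congr 1
  ext i
  have : (2 * i.val + 1) % 2 = 1 := by omega
  simp [σ, groupSort₂, pairFold, this]

/-- Layers are prepended, so widths double going backwards. The size identity is the geometric sum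
`2w + 4w + … + 2^b w`, written without subtraction. -/
theorem exists_iterate {p w : ℕ} {C : ℝ} {op : ℝ → ℝ → ℝ}
    (hop : ∀ {w : ℕ}, 0 < w → ∀ L : GroupSortLayers p w, L.Bounded C → ∀ {n : ℕ}, n = w * 2 →
      ∃ L' : GroupSortLayers p n, L'.length = L.length + 1 ∧ L'.size = n + L.size ∧
        L'.Bounded C ∧ ∀ f : ℕ → ℝ, L'.eval (fun i => f i) = L.eval (fun i => pairFold op f i))
    (hw : 0 < w) (L : GroupSortLayers p w) (hL : L.Bounded C) (b : ℕ) :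
    ∃ L' : GroupSortLayers p (w * 2 ^ b), L'.length = L.length + b ∧
      L'.size + 2 * w = w * 2 ^ (b + 1) + L.size ∧
      L'.Bounded C ∧ ∀ f : ℕ → ℝ,
        L'.eval (fun i => f i) = L.eval (fun i => (pairFold op)^[b] f i) := by
  induction b with
  | zero =>
    rw [pow_zero, mul_one]
    exact ⟨L, rfl, by ring, hL, fun f => rfl⟩
  | succ b ih =>
    obtain ⟨L₁, h1, h2, h3, h4⟩ := ih
    obtain ⟨L₂, k1, k2, k3, k4⟩ := hop (by positivity) L₁ h3 (n := w * 2 ^ (b + 1)) (by ring)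
    refine ⟨L₂, by omega, by rw [k2, add_assoc, h2]; ring, k3, fun f => ?_⟩
    rw [k4, h4]
    rfl

end GroupSortLayers

/-! ### Max-min networks and interpolation -/

theorem exists_maxMin_net {d p : ℕ} (hp : 0 < p) {C : ℝ} (hC : 0 ≤ C) (b c : ℕ)
    (w : ℕ → EuclideanSpace ℝ (Fin d)) (β : ℕ → ℝ) (hw : ∀ n, ‖w n‖ ≤ 1) (hβ : ∀ n, |β n| ≤ C) :
    ∃ N : GroupSortNet d p, N.depth = b + c + 1 ∧ N.size ≤ p * 2 ^ (b + c + 1) ∧ N.Bounded C ∧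
      ∀ x (q : Fin p), N.eval x q =
        (pairFold max)^[c] ((pairFold min)^[b] fun n => inner ℝ (w n) x + β n) q := by
  obtain ⟨L₁, h1, h2, h3, h4⟩ := GroupSortLayers.exists_iterate
    (GroupSortLayers.exists_max hC) hp (.nil : GroupSortLayers p p) trivial c
  obtain ⟨L₂, k1, k2, k3, k4⟩ := GroupSortLayers.exists_iterate
    (GroupSortLayers.exists_min hC) (by positivity) L₁ h3 b
  refine ⟨⟨p * 2 ^ c * 2 ^ b, Matrix.of fun i j => w i j, fun i => β i, L₂⟩, ?_, ?_,
    ⟨matNormTwoInf_le_one _ fun i => hw i, ?_, k3⟩, fun x q => ?_⟩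
  · simp only [GroupSortLayers.length] at h1
    simp only [GroupSortNet.depth]
    omega
  · simp only [GroupSortLayers.size] at h2
    simp only [GroupSortNet.size]
    have e1 : p * 2 ^ c * 2 ^ (b + 1) = p * 2 ^ (b + c + 1) := by ring
    have e2 : p * 2 ^ (c + 1) = 2 * (p * 2 ^ c) := by ring
    omega
  · exact (pi_norm_le_iff_of_nonneg hC).2 fun i => hβ i
  · have e : (Matrix.of fun (i : Fin (p * 2 ^ c * 2 ^ b)) j => w i j).mulVec x.ofLp
        + (fun i : Fin (p * 2 ^ c * 2 ^ b) => β i) =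
        fun i : Fin (p * 2 ^ c * 2 ^ b) => inner ℝ (w i) x + β i := by
      ext i
      simp [Matrix.mulVec, dotProduct, PiLp.inner_apply, mul_comm]
    simp only [GroupSortNet.eval]
    rw [e, k4 fun n => inner ℝ (w n) x + β n, h4]
    simp only [GroupSortLayers.eval]

/-- `hsep` is required for every `j`, not only `j < m`: the tournament is padded to powers of two,
and the padding blocks must not exceed the data either. -/
theorem exists_interpolating_net {d p : ℕ} (hp : 0 < p) {C K B : ℝ} (hKB : K + B ≤ C)
    (hK : 0 ≤ K) (m r : ℕ)
    (y : ℕ → EuclideanSpace ℝ (Fin d)) (hy : ∀ j, ‖y j‖ ≤ B)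
    (v : ℕ → ℕ → ℝ) (hv : ∀ q j, |v q j| ≤ K)
    (w : ℕ → ℕ → ℕ → EuclideanSpace ℝ (Fin d)) (hw : ∀ q j k, ‖w q j k‖ ≤ 1)
    (hsep : ∀ q j, ∀ i < m, ∃ k < r, inner ℝ (w q j k) (y i - y j) ≤ v q i - v q j) :
    ∃ N : GroupSortNet d p, N.depth = Nat.clog 2 r + Nat.clog 2 m + 1 ∧
      N.size ≤ p * 2 ^ (Nat.clog 2 r + Nat.clog 2 m + 1) ∧ N.Bounded C ∧
      (∀ x x' (q : Fin p), |N.eval x q - N.eval x' q| ≤ ‖x - x'‖) ∧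
      ∀ i < m, ∀ q : Fin p, N.eval (y i) q = v q i := by
  have hB : 0 ≤ B := (norm_nonneg _).trans (hy 0)
  set b := Nat.clog 2 r
  set c := Nat.clog 2 m
  have hb : r ≤ 2 ^ b := Nat.le_pow_clog one_lt_two r
  have hc : m ≤ 2 ^ c := Nat.le_pow_clog one_lt_two m
  -- The affine piece `(q, j, k)` sits at position `2^b * (2^c * q + j) + k`; `J` recovers `j`.
  let J : ℕ → ℕ := fun n => n / 2 ^ b % 2 ^ c
  let W : ℕ → EuclideanSpace ℝ (Fin d) := fun n => w (n / 2 ^ b / 2 ^ c) (J n) (n % 2 ^ b)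
  let β : ℕ → ℝ := fun n => v (n / 2 ^ b / 2 ^ c) (J n) - inner ℝ (W n) (y (J n))
  have hW : ∀ n, ‖W n‖ ≤ 1 := fun n => hw _ _ _
  have hβ : ∀ n, |β n| ≤ C := fun n => by
    have h1 : |inner ℝ (W n) (y (J n))| ≤ B :=
      (abs_real_inner_le_norm _ _).trans
        ((mul_le_mul (hW n) (hy _) (norm_nonneg _) zero_le_one).trans (one_mul B).le)
    exact (abs_sub _ _).trans ((add_le_add (hv _ _) h1).trans hKB)
  obtain ⟨N, h1, h2, h3, h4⟩ := exists_maxMin_net hp ((add_nonneg hK hB).trans hKB) b c W β hW hβ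
  have hval : ∀ (q j k : ℕ) (x : EuclideanSpace ℝ (Fin d)), j < 2 ^ c → k < 2 ^ b →
      inner ℝ (W (2 ^ b * (2 ^ c * q + j) + k)) x + β (2 ^ b * (2 ^ c * q + j) + k)
        = v q j + inner ℝ (w q j k) (x - y j) := by
    intro q j k x hj hk
    have e1 : (2 ^ b * (2 ^ c * q + j) + k) / 2 ^ b = 2 ^ c * q + j := by
      rw [Nat.mul_add_div (by positivity), Nat.div_eq_of_lt hk, add_zero]
    have e2 : (2 ^ c * q + j) / 2 ^ c = q := by
      rw [Nat.mul_add_div (by positivity), Nat.div_eq_of_lt hj, add_zero]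
    have e3 : (2 ^ b * (2 ^ c * q + j) + k) % 2 ^ b = k := by
      rw [Nat.mul_add_mod, Nat.mod_eq_of_lt hk]
    have e4 : (2 ^ c * q + j) % 2 ^ c = j := by
      rw [Nat.mul_add_mod, Nat.mod_eq_of_lt hj]
    simp only [β, W, J, e1, e2, e3, e4, inner_sub_right]
    ring
  refine ⟨N, h1, h2, h3, fun x x' q => ?_, fun i hi q => le_antisymm ?_ ?_⟩
  · rw [h4, h4]
    refine abs_pairFold_iterate_sub_le abs_max_sub_max_le_max c
      (abs_pairFold_iterate_sub_le abs_min_sub_min_le_max b fun n => ?_) q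
    rw [add_sub_add_right_eq_sub, ← inner_sub_right]
    exact (abs_real_inner_le_norm _ _).trans
      (mul_le_of_le_one_left (norm_nonneg _) (hW n))
  -- Upper bound: in each block the piece given by `hsep` is below the data at `y i`.
  · rw [h4, pairFold_max_iterate_le]
    intro j hj
    obtain ⟨k, hk, h⟩ := hsep q j i hi
    refine ((le_pairFold_min_iterate b _ _ _).1 le_rfl k (hk.trans_le hb)).trans ?_
    rw [hval _ _ _ _ hj (hk.trans_le hb)]
    linarith
  -- Lower bound: all pieces of block `i` equal `v q i` at `y i`.
  · rw [h4]
    refine le_trans ?_ ((pairFold_max_iterate_le c _ _ _).1 le_rfl i (hi.trans_le hc))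
    rw [le_pairFold_min_iterate]
    intro k hk
    rw [hval _ _ _ _ (hi.trans_le hc) hk]
    simp

/-! ### Nets and counting -/

theorem norm_le_sqrt_card_mul {n : ℕ} {a : ℝ} (x : EuclideanSpace ℝ (Fin n))
    (h : ∀ i, ‖x i‖ ≤ a) : ‖x‖ ≤ √n * a := by
  rcases Nat.eq_zero_or_pos n with rfl | hn
  · simp [EuclideanSpace.norm_eq]
  · have ha : 0 ≤ a := (norm_nonneg _).trans (h ⟨0, hn⟩)
    rw [EuclideanSpace.norm_eq, ← Real.sqrt_sq ha, ← Real.sqrt_mul (Nat.cast_nonneg n)]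
    refine Real.sqrt_le_sqrt ((Finset.sum_le_sum fun i _ =>
      pow_le_pow_left₀ (norm_nonneg _) (h i) 2).trans_eq ?_)
    simp

/-- One representative is chosen in each occupied cube of side `1/u`. Taking it in `Ω` rather than
at the cube's centre matters because `g` is defined only on `Ω`. -/
theorem exists_grid_net {d : ℕ} {Ω : Set (EuclideanSpace ℝ (Fin d))} {R u : ℝ}
    (hΩ : Ω ⊆ Metric.closedBall 0 R) (hne : Ω.Nonempty) (hu : 0 < u) :
    ∃ (m : ℕ) (y : ℕ → Ω), m ≤ (2 * ⌈R * u⌉₊ + 1) ^ d ∧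
      ∀ x : Ω, ∃ i < m, ‖(x : EuclideanSpace ℝ (Fin d)) - y i‖ ≤ √d / u := by
  classical
  obtain ⟨x₀, hx₀⟩ := hne
  set M : ℕ := ⌈R * u⌉₊
  let cell : Ω → Fin d → ℤ := fun x i => ⌊u * (x : EuclideanSpace ℝ (Fin d)) i⌋
  let S : Finset (Fin d → ℤ) := Fintype.piFinset fun _ => Finset.Icc (-M : ℤ) M
  let T := S.filter fun s => ∃ x, cell x = s
  have hcard : T.card ≤ (2 * M + 1) ^ d := by
    refine (Finset.card_filter_le _ _).trans_eq ?_
    rw [Fintype.card_piFinset]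
    simp only [Int.card_Icc, Finset.prod_const, Finset.card_univ, Fintype.card_fin]
    congr 1
    omega
  have hmem : ∀ x, cell x ∈ T := by
    intro x
    refine Finset.mem_filter.2 ⟨Fintype.mem_piFinset.2 fun i => ?_, x, rfl⟩
    have h1 : |(x : EuclideanSpace ℝ (Fin d)) i| ≤ R := by
      have := hΩ x.2
      rw [mem_closedBall_zero_iff] at this
      exact (PiLp.norm_apply_le (x : EuclideanSpace ℝ (Fin d)) i).trans this
    obtain ⟨h2, h3⟩ := abs_le.1 h1
    have h4 : R * u ≤ M := Nat.le_ceil _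
    rw [Finset.mem_Icc]
    constructor
    · rw [Int.le_floor]
      push_cast
      nlinarith
    · have : (cell x i : ℝ) ≤ M := (Int.floor_le _).trans (by nlinarith)
      exact_mod_cast this
  have hT : ∀ s : T, ∃ x, cell x = s := fun s => (Finset.mem_filter.1 s.2).2
  choose z hz using hT
  refine ⟨T.card, fun i => if h : i < T.card then z (T.equivFin.symm ⟨i, h⟩) else ⟨x₀, hx₀⟩,
    hcard, fun x => ?_⟩
  refine ⟨T.equivFin ⟨cell x, hmem x⟩, Fin.is_lt _, ?_⟩
  simp only [Fin.is_lt, dite_true, Fin.eta, Equiv.symm_apply_apply]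
  set x' := z ⟨cell x, hmem x⟩
  have hc : cell x' = cell x := hz _
  have hi : ∀ i, ‖((x : EuclideanSpace ℝ (Fin d)) - x') i‖ ≤ 1 / u := by
    intro i
    have h : |u * (x : EuclideanSpace ℝ (Fin d)) i - u * (x' : EuclideanSpace ℝ (Fin d)) i| < 1 :=
      Int.abs_sub_lt_one_of_floor_eq_floor (congrFun hc i).symm
    rw [← mul_sub, abs_mul, abs_of_pos hu] at h
    rw [le_div_iff₀ hu, mul_comm]
    exact h.le
  exact (norm_le_sqrt_card_mul _ hi).trans_eq (by ring)

/-- For `d` above a threshold depending on `R`, `√d ≤ R * u` forces `5R ≤ u`, so the left side is at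
most `u^(4d) ≤ u^(d^2)`. The finitely many smaller `d` go into the constant. -/
theorem exists_const_mul_pow_le (R : ℝ) (hR : 1 ≤ R) :
    ∃ c : ℝ, 0 < c ∧ ∀ (d : ℕ) (u : ℝ), 2 ≤ d → √d ≤ R * u →
      (5 * R * u) ^ (2 * d) ≤ c * u ^ (d ^ 2) := by
  set D : ℕ := ⌈25 * R ^ 4⌉₊
  have hR0 : 0 < R := by linarith
  have hc : 1 ≤ (5 * R) ^ (2 * D) * R ^ (D ^ 2) :=
    one_le_mul_of_one_le_of_one_le (one_le_pow₀ (by linarith)) (one_le_pow₀ hR)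
  refine ⟨(5 * R) ^ (2 * D) * R ^ (D ^ 2), by linarith, fun d u hd hu => ?_⟩
  have hd1 : (1 : ℝ) ≤ √d := by
    rw [Real.one_le_sqrt]; exact_mod_cast (by omega : 1 ≤ d)
  have hRu : 1 ≤ R * u := hd1.trans hu
  have hu0 : 0 < u := by by_contra! h; nlinarith
  have hdd : 2 * d ≤ d ^ 2 := by nlinarith
  rcases le_or_gt d D with h | h
  · have h1 : (5 * R) ^ (2 * d) ≤ (5 * R) ^ (2 * D) := pow_le_pow_right₀ (by linarith) (by omega)
    have h2 : R ^ (d ^ 2 - 2 * d) ≤ R ^ (D ^ 2) :=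
      pow_le_pow_right₀ hR ((Nat.sub_le _ _).trans (Nat.pow_le_pow_left h 2))
    -- Here `u` may be below 1, so the missing powers are supplied by `R * u ≥ 1`.
    have h3 : 1 ≤ (R * u) ^ (d ^ 2 - 2 * d) := one_le_pow₀ hRu
    have h4 : u ^ (d ^ 2) = u ^ (d ^ 2 - 2 * d) * u ^ (2 * d) := by
      rw [← pow_add, Nat.sub_add_cancel hdd]
    calc (5 * R * u) ^ (2 * d) = (5 * R) ^ (2 * d) * u ^ (2 * d) := mul_pow _ _ _
      _ ≤ (5 * R) ^ (2 * D) * (u ^ (2 * d) * (R * u) ^ (d ^ 2 - 2 * d)) := by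
          gcongr
          exact le_mul_of_one_le_right (by positivity) h3
      _ = (5 * R) ^ (2 * D) * R ^ (d ^ 2 - 2 * d) * u ^ (d ^ 2) := by
          rw [h4, mul_pow]; ring
      _ ≤ _ := by gcongr
  · have h1 : 25 * R ^ 4 ≤ d := (Nat.le_ceil _).trans (by exact_mod_cast h.le)
    have h2 : 5 * R ^ 2 ≤ √d := Real.le_sqrt_of_sq_le (by nlinarith)
    have h3 : 5 * R ≤ u := by
      refine le_of_mul_le_mul_left ?_ hR0
      nlinarith
    have hu1 : 1 ≤ u := by linarith
    have hd4 : 4 ≤ d := by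
      have : (4 : ℝ) ≤ d := by nlinarith [one_le_pow₀ hR (n := 4)]
      exact_mod_cast this
    calc (5 * R * u) ^ (2 * d) ≤ (u * u) ^ (2 * d) := by gcongr
      _ = u ^ (4 * d) := by rw [← pow_two, ← pow_mul]; ring_nf
      _ ≤ u ^ (d ^ 2) := pow_le_pow_right₀ hu1 (by nlinarith)
      _ ≤ _ := le_mul_of_one_le_left (by positivity) hc

theorem two_pow_clog_le {n : ℕ} (hn : 1 ≤ n) : 2 ^ Nat.clog 2 n ≤ 2 * n := by
  rcases hn.eq_or_lt with rfl | h
  · simp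
  · have h1 := Nat.pow_pred_clog_lt_self one_lt_two h
    have h2 : 0 < Nat.clog 2 n := Nat.clog_pos one_lt_two h
    obtain ⟨k, hk⟩ := Nat.exists_eq_succ_of_ne_zero h2.ne'
    rw [hk] at h1 ⊢
    rw [pow_succ]
    simp only [Nat.pred_succ] at h1
    omega

/-! ### Slopes and approximation of a Lipschitz map -/

/-- Slopes of affine functions through one data point lying below the data at another one. -/
theorem exists_slopes {d : ℕ} (hd : 1 ≤ d) {Ω : Set (EuclideanSpace ℝ (Fin d))} (m : ℕ)
    (y : ℕ → Ω) (v : ℕ → Ω → ℝ) (hv : ∀ q, LipschitzWith 1 (v q)) :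
    ∃ (w : ℕ → ℕ → ℕ → EuclideanSpace ℝ (Fin d)), (∀ q j k, ‖w q j k‖ ≤ 1) ∧
      ∀ q j, ∀ i < m, ∃ k < if d = 1 then 2 else m,
        inner ℝ (w q j k) ((y i : EuclideanSpace ℝ (Fin d)) - y j) ≤ v q (y i) - v q (y j) := by
  have hlip : ∀ q (a b : Ω), |v q a - v q b| ≤ ‖(a : EuclideanSpace ℝ (Fin d)) - b‖ := by
    intro q a b
    have := (hv q).dist_le_mul a b
    rwa [NNReal.coe_one, one_mul, Real.dist_eq, Subtype.dist_eq, dist_eq_norm] at this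
  by_cases h1 : d = 1
  · subst h1
    -- On the line, one of the slopes `±1` gives `-|y i - y j|`, the least increment the Lipschitz
    -- bound allows.
    refine ⟨fun _ _ k => EuclideanSpace.single 0 (if k = 0 then 1 else -1), fun q j k => ?_,
      fun q j i _ => ?_⟩
    · by_cases h : k = 0 <;> simp [h]
    · have h := neg_le_of_abs_le (hlip q (y i) (y j))
      rw [EuclideanSpace.norm_eq, Fin.sum_univ_one, Real.sqrt_sq (norm_nonneg _),
        Real.norm_eq_abs] at h
      simp only [if_true]
      rcases abs_cases (((y i : EuclideanSpace ℝ (Fin 1)) - y j) 0) with ⟨e, -⟩ | ⟨e, -⟩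
      · refine ⟨1, by norm_num, le_trans (le_of_eq ?_) h⟩
        rw [e]; simp [PiLp.inner_apply]
      · refine ⟨0, by norm_num, le_trans (le_of_eq ?_) h⟩
        rw [e]; simp [PiLp.inner_apply]
  · simp only [if_neg h1]
    -- The `k`-th slope points along `y k - y j` and matches the data at `y k`; the Lipschitz bound
    -- makes its norm at most 1. If the points coincide, division by zero gives slope 0.
    refine ⟨fun q j k => ((v q (y k) - v q (y j)) /
      ‖(y k : EuclideanSpace ℝ (Fin d)) - y j‖ ^ 2) • ((y k : EuclideanSpace ℝ (Fin d)) - y j),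
      fun q j k => ?_, fun q j i hi => ⟨i, hi, ?_⟩⟩
    · rw [norm_smul, Real.norm_eq_abs, abs_div, abs_of_nonneg (sq_nonneg ‖_‖)]
      have := hlip q (y k) (y j)
      set n := ‖(y k : EuclideanSpace ℝ (Fin d)) - y j‖
      have hn : 0 ≤ n := norm_nonneg _
      rcases hn.eq_or_lt with h | h
      · rw [← h]; simp
      · rw [div_mul_eq_mul_div, div_le_one (by positivity)]
        nlinarith
    · rw [real_inner_smul_left, real_inner_self_eq_norm_sq]
      have := hlip q (y i) (y j)
      set n := ‖(y i : EuclideanSpace ℝ (Fin d)) - y j‖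
      by_cases h : n = 0
      · rw [h] at this ⊢
        rw [abs_nonpos_iff.1 this]; simp
      · rw [div_mul_cancel₀ _ (pow_ne_zero 2 h)]

theorem exists_approximating_net {d p : ℕ} (hd : 1 ≤ d) (hp : 1 ≤ p)
    {Ω : Set (EuclideanSpace ℝ (Fin d))} {R u K B C : ℝ} (hR : 1 ≤ R)
    (hΩ : Ω ⊆ Metric.closedBall 0 R) (hne : Ω.Nonempty) (hu : √d ≤ R * u)
    (hB : ∀ x ∈ Ω, ‖x‖ ≤ B) (hK : 0 ≤ K) (hC : K + B ≤ C)
    (g : Ω → EuclideanSpace ℝ (Fin p)) (hg : LipschitzWith 1 g) (hgK : ∀ x, ‖g x‖ ≤ K) :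
    ∃ (N : GroupSortNet d p) (a : ℕ), N.depth = a + 1 ∧ N.size ≤ p * 2 ^ (a + 1) ∧
      N.Bounded C ∧ (2 : ℝ) ^ a ≤ (if d = 1 then 8 * (5 * R * u) else 4 * (5 * R * u) ^ (2 * d)) ∧
      ∀ x : Ω, ‖N.eval x - g x‖ ≤ √p * (2 * (√d / u)) := by
  have hd1 : (1 : ℝ) ≤ √d := by
    rw [Real.one_le_sqrt]; exact_mod_cast hd
  have hRu : 1 ≤ R * u := hd1.trans hu
  have hu0 : 0 < u := by by_contra! h; nlinarith
  obtain ⟨m, y, hm, hy⟩ := exists_grid_net hΩ hne hu0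
  have hm0 : 1 ≤ m := by
    obtain ⟨x, hx⟩ := hne
    obtain ⟨i, hi, -⟩ := hy ⟨x, hx⟩
    omega
  have hm' : (m : ℝ) ≤ (5 * R * u) ^ d := by
    have h1 : (⌈R * u⌉₊ : ℝ) < R * u + 1 := Nat.ceil_lt_add_one (by linarith)
    calc (m : ℝ) ≤ (2 * ⌈R * u⌉₊ + 1) ^ d := by exact_mod_cast hm
      -- `2⌈Ru⌉ + 1 ≤ 2Ru + 3 ≤ 5Ru`, since `Ru ≥ 1`.
      _ ≤ _ := by gcongr; linarith
  let v : ℕ → Ω → ℝ := fun q x => if h : q < p then g x ⟨q, h⟩ else 0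
  have hvK : ∀ q x, |v q x| ≤ K := by
    intro q x
    by_cases h : q < p
    · simp only [v, h, dite_true]
      exact (PiLp.norm_apply_le (g x) _).trans (hgK x)
    · simp [v, h, hK]
  have hvL : ∀ q, LipschitzWith 1 (v q) := by
    intro q
    refine LipschitzWith.of_dist_le_mul fun x x' => ?_
    by_cases h : q < p
    · simp only [v, h, dite_true]
      refine le_trans ?_ (hg.dist_le_mul x x')
      rw [Real.dist_eq, dist_eq_norm]
      exact PiLp.norm_apply_le (g x - g x') ⟨q, h⟩
    · simp [v, h]
  obtain ⟨w, hw, hsep⟩ := exists_slopes hd m y v hvL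
  set r := if d = 1 then 2 else m
  have hr0 : 1 ≤ r := by simp only [r]; split_ifs <;> omega
  obtain ⟨N, h1, h2, h3, h4, h5⟩ := exists_interpolating_net (by omega : 0 < p) hC hK m r
    (fun j => (y j : EuclideanSpace ℝ (Fin d))) (fun j => hB _ (y j).2) (fun q j => v q (y j))
    (fun q j => hvK _ _) w hw hsep
  refine ⟨N, Nat.clog 2 r + Nat.clog 2 m, h1, h2, h3, ?_, fun x => ?_⟩
  · have h6 : (2 : ℝ) ^ (Nat.clog 2 r + Nat.clog 2 m) ≤ 2 * r * (2 * m) := by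
      rw [pow_add]
      exact_mod_cast Nat.mul_le_mul (two_pow_clog_le hr0) (two_pow_clog_le hm0)
    refine h6.trans ?_
    simp only [r]
    split_ifs with h
    · subst h
      rw [pow_one] at hm'
      push_cast
      linarith
    · have : (m : ℝ) * m ≤ (5 * R * u) ^ d * (5 * R * u) ^ d := by gcongr
      rw [two_mul d, pow_add]
      linarith
  · obtain ⟨i, hi, hxi⟩ := hy x
    refine norm_le_sqrt_card_mul _ fun q => ?_
    have e1 := h4 x (y i) q
    have e2 := h5 i hi q
    have e3 := (hvL q).dist_le_mul (y i) x
    rw [NNReal.coe_one, one_mul, Real.dist_eq, Subtype.dist_eq, dist_comm, dist_eq_norm] at e3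
    have e4 : v q x = g x q := by simp [v]
    have e5 : (N.eval x - g x) q = N.eval x q - N.eval (y i) q + (v q (y i) - v q x) := by
      rw [e2, e4, PiLp.sub_apply]; ring
    rw [e5]
    exact (abs_add_le _ _).trans (by linarith)

theorem exists_constant_net {d p : ℕ} {C : ℝ} (v : EuclideanSpace ℝ (Fin p)) (hv : ‖v‖ ≤ C) :
    ∃ N : GroupSortNet d p, N.depth = 1 ∧ N.size = 0 ∧ N.Bounded C ∧ ∀ x, N.eval x = v := by
  refine ⟨⟨p, Matrix.of fun i j => (0 : Fin p → EuclideanSpace ℝ (Fin d)) i j, v.ofLp, .nil⟩,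
    rfl, rfl, ⟨matNormTwoInf_le_one _ (by simp), ?_, trivial⟩, fun x => ?_⟩
  · exact (pi_norm_le_iff_of_nonneg ((norm_nonneg v).trans hv)).2 fun i =>
      (PiLp.norm_apply_le v i).trans hv
  · ext q
    simp [GroupSortNet.eval, GroupSortLayers.eval, Matrix.mulVec, dotProduct]

/-! ### Choice of parameters -/

theorem theorem2 (R : ℝ) :
    ∃ c : ℝ, 0 < c ∧
      ∀ (d p : ℕ), 1 ≤ d → 1 ≤ p →
      ∀ Ω : Set (EuclideanSpace ℝ (Fin d)), IsCompact Ω → Ω ⊆ Metric.closedBall 0 R →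
      ∀ K ε : ℝ, 0 < K → 0 < ε →
      ∀ 𝒢 : Set (Ω → EuclideanSpace ℝ (Fin p)),
        (∀ g ∈ 𝒢, LipschitzWith 1 g) → (∀ g ∈ 𝒢, ∀ x : Ω, ‖g x‖ ≤ K) →
      ∀ g ∈ 𝒢, ∃ l s : ℕ,
        (l : ℝ) ≤ c * ((d : ℝ) ^ 2 * max 1 (Real.logb 2 (2 * √(d : ℝ) * √(p : ℝ) / ε))) ∧
        (s : ℝ) ≤ c * ((p : ℝ) * (2 * √(d : ℝ) * √(p : ℝ) / ε) ^ (d ^ 2)) ∧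
        ∃ N ∈ groupSortClass d p
            (K + √(d : ℝ) * ((⨆ x : Ω, ‖(x : EuclideanSpace ℝ (Fin d))‖) + 1) + ε) l s,
          ∀ x : Ω, ‖N (x : EuclideanSpace ℝ (Fin d)) - g x‖ ≤ ε := by
  obtain ⟨c₀, hc₀, hpow⟩ := exists_const_mul_pow_le (max R 1) (le_max_right _ _)
  have hR : (1 : ℝ) ≤ max R 1 := le_max_right _ _
  set ρ := max R 1 with hρ
  have hlog : 0 ≤ Real.logb 2 (5 * ρ) := Real.logb_nonneg one_lt_two (by linarith)
  -- The first two terms pay for the depth; `80 * ρ` and `8 * c₀` pay for the size when `d = 1` and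
  -- `d ≥ 2`.
  refine ⟨6 + 2 * Real.logb 2 (5 * ρ) + 80 * ρ + 8 * c₀, by positivity, ?_⟩
  intro d p hd hp Ω _ hΩ K ε hK hε 𝒢 hLip hbd g hg
  set u := 2 * √(d : ℝ) * √(p : ℝ) / ε with hu
  set M := max 1 (Real.logb 2 u) with hM
  have hM1 : 1 ≤ M := le_max_left _ _
  have hd1 : (1 : ℝ) ≤ d := by exact_mod_cast hd
  have hp1 : (1 : ℝ) ≤ p := by exact_mod_cast hp
  have hsd : (1 : ℝ) ≤ √d := Real.one_le_sqrt.2 hd1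
  have hsp : (1 : ℝ) ≤ √p := Real.one_le_sqrt.2 hp1
  have hu0 : 0 < u := by positivity
  have hdM : 1 ≤ (d : ℝ) ^ 2 * M := one_le_mul_of_one_le_of_one_le (one_le_pow₀ hd1) hM1
  have hS0 : 0 ≤ ⨆ x : Ω, ‖(x : EuclideanSpace ℝ (Fin d))‖ :=
    Real.iSup_nonneg fun x => norm_nonneg _
  set S := ⨆ x : Ω, ‖(x : EuclideanSpace ℝ (Fin d))‖ with hS
  have hC : K + S ≤ K + √(d : ℝ) * (S + 1) + ε := by nlinarith
  have hconst : ∀ v : EuclideanSpace ℝ (Fin p), ‖v‖ ≤ K → (∀ x, ‖v - g x‖ ≤ ε) → ∃ l s : ℕ,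
        (l : ℝ) ≤ (6 + 2 * Real.logb 2 (5 * ρ) + 80 * ρ + 8 * c₀) * ((d : ℝ) ^ 2 * M) ∧
        (s : ℝ) ≤ (6 + 2 * Real.logb 2 (5 * ρ) + 80 * ρ + 8 * c₀) * ((p : ℝ) * u ^ (d ^ 2)) ∧
        ∃ N ∈ groupSortClass d p (K + √(d : ℝ) * (S + 1) + ε) l s,
          ∀ x : Ω, ‖N (x : EuclideanSpace ℝ (Fin d)) - g x‖ ≤ ε := by
    intro v hv hvg
    obtain ⟨N, h1, h2, h3, h4⟩ := exists_constant_net (d := d) v (hv.trans (by linarith) :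
      ‖v‖ ≤ K + √(d : ℝ) * (S + 1) + ε)
    refine ⟨1, 0, ?_, ?_, N.eval, ⟨N, h1, h2, h3, rfl⟩, fun x => by rw [h4]; exact hvg x⟩
    · rw [Nat.cast_one]
      exact one_le_mul_of_one_le_of_one_le (by linarith) hdM
    · rw [Nat.cast_zero]; positivity
  have hball : ∀ x ∈ Ω, ‖x‖ ≤ ρ := fun x hx =>
    (mem_closedBall_zero_iff.1 (hΩ hx)).trans (le_max_left _ _)
  rcases Ω.eq_empty_or_nonempty with hE | hne
  · exact hconst 0 (by simpa using hK.le) fun x => absurd x.2 (by simp [hE])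
  -- For `ε` at least the diameter bound `2ρ`, a constant network of size 0 suffices; otherwise `√d
  -- ≤ ρ * u`, as the counting needs.
  rcases le_or_gt (2 * ρ) ε with hbig | hsmall
  · obtain ⟨x₀, hx₀⟩ := hne
    refine hconst (g ⟨x₀, hx₀⟩) (hbd g hg _) fun x => ?_
    have h := (hLip g hg).dist_le_mul ⟨x₀, hx₀⟩ x
    rw [NNReal.coe_one, one_mul, Subtype.dist_eq, dist_eq_norm, dist_eq_norm] at h
    have h' := norm_sub_le x₀ (x : EuclideanSpace ℝ (Fin d))
    have := hball x₀ hx₀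
    have := hball x x.2
    linarith
  have hdu : √d ≤ ρ * u := by
    rw [hu, mul_div_assoc', le_div_iff₀ hε]
    have : √(d : ℝ) * ε ≤ √d * (2 * ρ) := by gcongr
    have : √(d : ℝ) * (2 * ρ) * 1 ≤ √d * (2 * ρ) * √p := by gcongr
    linarith
  have hbdd : BddAbove (range fun x : Ω => ‖(x : EuclideanSpace ℝ (Fin d))‖) :=
    ⟨ρ, by rintro _ ⟨x, rfl⟩; exact hball x x.2⟩
  obtain ⟨N, a, h1, h2, h3, h4, h5⟩ := exists_approximating_net hd hp hR
    (hΩ.trans (Metric.closedBall_subset_closedBall (le_max_left _ _))) hne hdu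
    (fun x hx => le_ciSup hbdd (⟨x, hx⟩ : Ω)) hK.le hC g (hLip g hg) (hbd g hg)
  have hX : 1 ≤ 5 * ρ * u := by nlinarith
  refine ⟨N.depth, N.size, ?_, ?_, N.eval, ⟨N, rfl, rfl, h3, rfl⟩, fun x => (h5 x).trans_eq ?_⟩
  · have h6 : (2 : ℝ) ^ a ≤ 8 * (5 * ρ * u) ^ (2 * d) := by
      refine h4.trans ?_
      split_ifs with h
      · have := le_self_pow₀ hX (by omega : 2 * d ≠ 0)
        linarith
      · have : 0 ≤ (5 * ρ * u) ^ (2 * d) := by positivity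
        linarith
    have h7 : (a : ℝ) ≤ 3 + 2 * d * (Real.logb 2 (5 * ρ) + Real.logb 2 u) := by
      have := Real.logb_le_logb_of_le one_lt_two (by positivity) h6
      rw [Real.logb_pow, Real.logb_self_eq_one one_lt_two, mul_one,
        Real.logb_mul (by norm_num) (by positivity), Real.logb_pow,
        Real.logb_mul (by positivity) hu0.ne', show (8 : ℝ) = 2 ^ 3 by norm_num,
        Real.logb_pow, Real.logb_self_eq_one one_lt_two] at this
      push_cast at this
      linarith
    have h8 : Real.logb 2 (5 * ρ) + Real.logb 2 u ≤ (Real.logb 2 (5 * ρ) + 1) * M := by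
      have : Real.logb 2 u ≤ M := le_max_right _ _
      nlinarith
    have h9 : 2 * (d : ℝ) * (Real.logb 2 (5 * ρ) + Real.logb 2 u)
        ≤ 2 * (d : ℝ) ^ 2 * ((Real.logb 2 (5 * ρ) + 1) * M) := by
      have h0 : 0 ≤ (Real.logb 2 (5 * ρ) + 1) * M := by positivity
      refine (mul_le_mul_of_nonneg_left h8 (by positivity)).trans
        (mul_le_mul_of_nonneg_right ?_ h0)
      nlinarith
    rw [h1]
    push_cast
    have h10 : 0 ≤ (80 * ρ + 8 * c₀) * ((d : ℝ) ^ 2 * M) := by positivity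
    linarith
  · have h6 : (2 : ℝ) ^ a ≤ (40 * ρ + 4 * c₀) * u ^ (d ^ 2) := by
      have hu' : 0 ≤ u ^ (d ^ 2) := by positivity
      refine h4.trans ?_
      split_ifs with h
      · subst h
        norm_num
        nlinarith
      · have := hpow d u (by omega) hdu
        nlinarith [mul_nonneg (by linarith : 0 ≤ 40 * ρ) hu']
    calc (N.size : ℝ) ≤ p * 2 ^ (a + 1) := by exact_mod_cast h2
      _ = p * 2 * 2 ^ a := by ring
      _ ≤ p * 2 * ((40 * ρ + 4 * c₀) * u ^ (d ^ 2)) := by gcongr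
      _ = (80 * ρ + 8 * c₀) * (p * u ^ (d ^ 2)) := by ring
      _ ≤ _ := by gcongr; linarith
  -- The mesh is `√d / u = ε / (2√p)`, so the error bound is exactly `ε`.
  · rw [hu]
    field_simp
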